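/- A finite hypergraph $\mathbb H$ consists of a finite set $V$ of hypervertices and a finite family $E$ of hyperedges, each a nonempty subset of $V$ (the same subset may occur several times), whose union is $V$; it is connected if any two hypervertices are joined by a sequence of hypervertices in which consecutive ones lie in a common hyperedge. Its bipartite incidence graph $B_{\mathbb H}$ has vertex set $V\sqcup E$, with $v\in V$ adjacent to $e\in E$ iff $v\in e$. A closed path of length $k\ge 1$ in $\mathbb H$ is a sequence $c=(v_1,e_1,v_2,e_2,\dots,v_k,e_k,v_1)$ with $v_i,v_{i+1}\in e_i$ and $v_i\ne v_{i+1}$ for all $i$ modulo $k$. It has hyperedge backtracking if it contains a subsequence $(e,v,e)$ of consecutive terms, and it is tail-less if $c^2$ ($c$ traversed twice) has no hyperedge backtracking. A primitive cycle is a closed path without hyperedge backtracking that is tail-less and is not $b^m$ for any closed path $b$ and any $m\ge 2$; a prime cycle is a class of primitive cycles under cyclic permutation. For $u\in\mathbb C$ with $|u|$ sufficiently small, the generalized Ihara-Selberg zeta function is $$\zeta_{\mathbb H}(u)=\prod_{\mathfrak p}\bigl(1-u^{|\mathfrak p|}\bigr)^{-1},$$ the product being over the prime cycles $\mathfrak p$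 of $\mathbb H$ and $|\mathfrak p|$ denoting length. The Ihara-Selberg zeta function $Z_X(u)$ of a finite graph $X$ is the analogous product over the prime cycles of $X$, that is, the classes under cyclic permutation of closed edge paths that have no backtracking (traversing an edge and at once returning along the same edge), are tail-less, and are not proper multiples. **Corollary.** Let $\mathbb H$ be a finite connected hypergraph in which every hypervertex lies in at least two hyperedges. Let $A_{B_{\mathbb H}}$ be the adjacency operator of $B_{\mathbb H}$, let $Q_{B_{\mathbb H}}=D-I$ where $D$ is the diagonal operator of vertex degrees of $B_{\mathbb H}$, and let $\chi(B_{\mathbb H})=|V(B_{\mathbb H})|-|E(B_{\mathbb H})|$. Then there is $R\in(0,1]$ such that for all $u\in\mathbb C$ with $|u|<R$ and for either square root $\sqrt u$ of $u$, the products defining $\zeta_{\mathbb H}(u)$ and $Z_{B_{\mathbb H}}(\sqrt u)$ converge unconditionally, $\det\bigl(I-\sqrt u\,A_{B_{\mathbb H}}+u\,Q_{B_{\mathbb H}}\bigr)\neq 0$, and $$\zeta_{\mathbb H}(u)=Z_{B_{\mathbb H}}(\sqrt u)=(1-u)^{\chi(B_{\mathbb H})}\det\bigl(I-\sqrt u\,A_{B_{\mathbb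 H}}+u\,Q_{B_{\mathbb H}}\bigr)^{-1}.$$ -/

import Mathlib

/-! ### Closed paths and prime cycles over an alphabet of steps

A closed path is recorded as the nonempty list of its steps. `next a b` says that the step `b`
may follow the step `a`, and `bt a b` says that following `a` by `b` is a backtrack.  The class of
a list under cyclic permutation is its image in `Cycle α`. -/

namespace CyclicPath

variable {α : Type*}

/-- The list of steps `l` is a closed path: it has at least one step, each step may be followed by
its successor in `l`, and the last step may be followed by the first one. -/
def IsClosedPath (next : α → α → Prop) (l : List α) : Prop :=
  l ≠ [] ∧ (l : Cycle α).Chain next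

/-- Two steps of `l` in immediate succession form a backtrack (not read cyclically). -/
def HasBacktrack (bt : α → α → Prop) (l : List α) : Prop :=
  ∃ a b : α, [a, b] <:+: l ∧ bt a b

/-- The `m`-multiple of a closed path: going around it `m` times. -/
def multiple (m : ℕ) (l : List α) : List α :=
  (List.replicate m l).flatten

/-- A closed path is tail-less if its `2`-multiple has no backtrack. -/
def IsTailless (bt : α → α → Prop) (l : List α) : Prop :=
  ¬ HasBacktrack bt (multiple 2 l)

/-- A primitive cycle: a closed path without backtracks, tail-less, and not the `m`-multiple of a
closed path for any `m ≥ 2`. -/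
def IsPrimitive (next bt : α → α → Prop) (l : List α) : Prop :=
  IsClosedPath next l ∧ ¬ HasBacktrack bt l ∧ IsTailless bt l ∧
    ∀ (b : List α) (m : ℕ), IsClosedPath next b → 2 ≤ m → l ≠ multiple m b

/-- The prime cycles: the classes of the primitive cycles under cyclic permutation. -/
def primeCycles (next bt : α → α → Prop) : Set (Cycle α) :=
  {c | ∃ l : List α, IsPrimitive next bt l ∧ (l : Cycle α) = c}

end CyclicPath

/-! ### The Ihara-Selberg zeta function of a graph -/

namespace SimpleGraph

variable {W : Type*} (G : SimpleGraph W)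

/-- The prime cycles (prime geodesics) of a graph. A step is an edge with a direction of travel; a
step may be followed by those that start where it ends, and to backtrack is to traverse the same
edge at once in the opposite direction. -/
def iharaPrimes : Set (Cycle G.Dart) :=
  CyclicPath.primeCycles G.DartAdj (fun d d' => d' = d.symm)

/-- The factor `(1 - u ^ |p|)⁻¹` that a prime cycle `p` contributes to the Euler product. -/
noncomputable def iharaFactor (u : ℂ) (p : G.iharaPrimes) : ℂ :=
  (1 - u ^ (p : Cycle G.Dart).length)⁻¹

/-- The Ihara-Selberg zeta function of a graph, as an Euler product. -/
noncomputable def iharaZeta (u : ℂ) : ℂ :=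
  ∏' p : G.iharaPrimes, G.iharaFactor u p

/-- The Euler number `|V| - |E|` of a finite graph. -/
def eulerNumber [Fintype W] [DecidableRel G.Adj] : ℤ :=
  (Fintype.card W : ℤ) - (G.edgeFinset.card : ℤ)

end SimpleGraph

/-! ### Hypergraphs -/

/-- A hypergraph with hypervertices `V` and hyperedges indexed by `E`. Each hyperedge is a nonempty
finite set of hypervertices, and every hypervertex lies in some hyperedge. The same set may occur
as several hyperedges. -/
structure MultiHypergraph (V E : Type*) where
  edge : E → Finset V
  edge_nonempty : ∀ e, (edge e).Nonempty
  exists_mem_edge : ∀ v, ∃ e, v ∈ edge e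

namespace MultiHypergraph

variable {V E : Type*} (H : MultiHypergraph V E)

/-- Any two hypervertices are joined by a sequence of hypervertices in which consecutive ones lie in
a common hyperedge. -/
def Connected : Prop :=
  ∀ v w : V, Relation.ReflTransGen (fun x y => ∃ e, x ∈ H.edge e ∧ y ∈ H.edge e) v w

/-- The bipartite incidence graph. -/
def incidenceGraph : SimpleGraph (V ⊕ E) where
  Adj
    | Sum.inl v, Sum.inr e => v ∈ H.edge e
    | Sum.inr e, Sum.inl v => v ∈ H.edge e
    | _, _ => False
  symm := ⟨by rintro (v | e) (w | f) h <;> exact h⟩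
  loopless := ⟨by rintro (v | e) h <;> exact h⟩

noncomputable instance : DecidableRel H.incidenceGraph.Adj :=
  fun _ _ => Classical.propDecidable _

/-- The closed path `(v₁, e₁, v₂, e₂, …, v_k, e_k, v₁)` is recorded as the list of pairs
`(v₁, e₁), …, (v_k, e_k)`. The pair `(w, f)` may follow `(v, e)` if the hyperedge `e` leads from `v`
to `w`: both lie in `e`, and they are distinct (a hyperedge contains a hypervertex only once, so
`(v, e, v)` is not a step). -/
def Next (p q : V × E) : Prop :=
  p.1 ∈ H.edge p.2 ∧ q.1 ∈ H.edge p.2 ∧ p.1 ≠ q.1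

/-- The prime cycles of a hypergraph; the excluded backtracks are the hyperedge backtracks
`(e, v, e)`. -/
def primes : Set (Cycle (V × E)) :=
  CyclicPath.primeCycles H.Next (fun p q => p.2 = q.2)

/-- The factor `(1 - u ^ |p|)⁻¹` that a prime cycle `p` contributes to the Euler product. -/
noncomputable def zetaFactor (u : ℂ) (p : H.primes) : ℂ :=
  (1 - u ^ (p : Cycle (V × E)).length)⁻¹

/-- The generalized Ihara-Selberg zeta function of a hypergraph, as an Euler product. -/
noncomputable def zeta (u : ℂ) : ℂ :=
  ∏' p : H.primes, H.zetaFactor u p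

variable [Fintype V] [DecidableEq V] [Fintype E] [DecidableEq E]

/-- The adjacency operator `A` of the bipartite incidence graph. -/
noncomputable def adjOperator : Matrix (V ⊕ E) (V ⊕ E) ℂ :=
  H.incidenceGraph.adjMatrix ℂ

/-- The operator `Q = D - I` of the bipartite incidence graph, `D` the diagonal matrix of degrees. -/
noncomputable def qOperator : Matrix (V ⊕ E) (V ⊕ E) ℂ :=
  Matrix.diagonal (fun x => (H.incidenceGraph.degree x : ℂ)) - 1

end MultiHypergraph

/-!
Both zeta functions are instances of one Euler product. A closed path is a cyclic list of steps, and
without backtracks and tails it is a cyclic chain for the relation `Step next bt`; let `M` be the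
`0`-`1` matrix of this relation. Every cyclic chain is in exactly one way a multiple of a primitive
cycle (`CyclicPath.closedChainEquiv`), and a prime cycle of length `n` is the class of exactly `n`
primitive cycles (`CyclicPath.exists_equiv_toPrime_fiber`). Weighting a chain of length `k` by
`u ^ k / k` therefore gives
`∑_𝔭 -log (1 - u ^ |𝔭|) = ∑_k tr(M ^ k) u ^ k / k = log det (1 - u M)⁻¹`
for small `u`, all sums being absolutely convergent, and the exponential of this identity is
`CyclicPath.exists_hasProd_primeCycles`: the Euler product converges unconditionally to
`det (1 - u M)⁻¹`. The last equality above holds because `tr(M ^ k)` is the `k`-th power sum of the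
eigenvalues of `M`.

It remains to compare determinants. The darts of the incidence graph point either from a hypervertex
to a hyperedge or back, so its edge matrix consists of two off-diagonal blocks. Their product is the
step matrix of the hypergraph, up to indices with vanishing row, which yields
`det (1 - s N) = det (1 - s² M)` for the edge matrix `N` of the graph and the step matrix `M` of the
hypergraph (`MultiHypergraph.det_one_sub_smul_edgeMatrix`). This is the first equality of the
theorem. The second is the Ihara-Bass formula (`SimpleGraph.det_one_sub_adjMatrix_add_degree`),
proved for an arbitrary finite graph: `N = Tᵀ S - J`, where `S` and `T` are the incidence matrices of
starting and end points of darts and `J` reverses darts, so that `1 - s N` factors through `1 + s J`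
and the Weinstein-Aronszajn identity moves the remaining determinant from darts to vertices.
-/

/-! ### Eigenvalues of a polynomial in a matrix -/

namespace Matrix

open Polynomial

variable {n : Type*} [Fintype n] [DecidableEq n] {K : Type*} [Field K] [IsAlgClosed K]

/-- The determinant of `p(A)` is the product of the values of `p` at the eigenvalues of `A`: both
sides are multiplicative in `p`, so it suffices to compare them on constants and linear factors. -/
theorem det_aeval_eq_prod_roots_charpoly (A : Matrix n n K) (p : K[X]) :
    (aeval A p).det = (A.charpoly.roots.map fun z => p.eval z).prod := by
  have hroots := IsAlgClosed.splits A.charpoly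
  have hcard : A.charpoly.roots.card = Fintype.card n := by
    rw [← hroots.natDegree_eq_card_roots, charpoly_natDegree_eq_dim]
  have hlin (r : K) : (aeval A (X - C r)).det = (A.charpoly.roots.map fun z => z - r).prod := by
    have h1 : aeval A (X - C r) = -(scalar n r - A) := by
      simp [algebraMap_eq_diagonal, Pi.algebraMap_def]
    have h2 := congrArg (eval r) (hroots.eq_prod_roots_of_monic A.charpoly_monic)
    rw [eval_charpoly, eval_multiset_prod, Multiset.map_map] at h2
    have h3 := Multiset.prod_map_neg (A.charpoly.roots.map (eval r ∘ fun x => X - C x))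
    rw [Multiset.card_map, Multiset.map_map] at h3
    rw [h1, det_neg, h2, ← hcard, ← h3]
    simp
  let φ : K[X] →* K := (detMonoidHom (n := n) (R := K)).comp (aeval A : K[X] →ₐ[K] _)
  let ψ : K[X] →* K :=
    { toFun := fun q => (A.charpoly.roots.map fun z => q.eval z).prod
      map_one' := by simp
      map_mul' := fun q q' => by simp [Multiset.prod_map_mul] }
  change φ p = ψ p
  have hφ : ∀ r, φ (X - C r) = ψ (X - C r) := fun r => by simpa [φ, ψ] using hlin r
  rw [(IsAlgClosed.splits p).eq_prod_roots, map_mul, map_mul, map_multiset_prod, map_multiset_prod,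
    Multiset.map_map, Multiset.map_map]
  congr 1
  · simp [φ, ψ, hcard, algebraMap_eq_diagonal, Pi.algebraMap_def]
  · exact congrArg _ (Multiset.map_congr rfl fun r _ => hφ r)

/-- The eigenvalues of `A ^ k` are the `k`-th powers of those of `A`, with multiplicities. -/
theorem trace_pow_eq_sum_roots_charpoly (A : Matrix n n K) (k : ℕ) :
    (A ^ k).trace = (A.charpoly.roots.map (· ^ k)).sum := by
  have hcp : (A ^ k).charpoly = ((A.charpoly.roots.map (· ^ k)).map fun z => X - C z).prod := by
    refine Polynomial.funext fun x => ?_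
    have h1 : scalar n x - A ^ k = aeval A (C x - X ^ k) := by
      simp [algebraMap_eq_diagonal, Pi.algebraMap_def]
    rw [eval_charpoly, h1, det_aeval_eq_prod_roots_charpoly, eval_multiset_prod]
    simp [Multiset.map_map]
  rw [trace_eq_sum_roots_charpoly, hcp, roots_multiset_prod_X_sub_C]

theorem det_one_sub_smul_eq_prod_roots_charpoly (A : Matrix n n K) (u : K) :
    (1 - u • A).det = (A.charpoly.roots.map fun z => 1 - u * z).prod := by
  have h := det_aeval_eq_prod_roots_charpoly A (1 - C u * X)
  simpa [← Algebra.smul_def] using h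

end Matrix

namespace Matrix

variable {n : Type*} [Fintype n] [DecidableEq n]

/-- For small `u`, the series `∑ tr(A ^ k) u ^ k / k` converges absolutely to a logarithm of
`det (1 - u A)⁻¹`. The term `k = 0` vanishes because of the division by zero. -/
theorem exists_hasSum_trace_pow (A : Matrix n n ℂ) :
    ∃ r : ℝ, 0 < r ∧ ∀ u : ℂ, ‖u‖ < r → (1 - u • A).det ≠ 0 ∧
      ∃ S : ℂ, HasSum (fun k : ℕ => (A ^ k).trace * (u ^ k / k)) S ∧
        Complex.exp S = ((1 - u • A).det)⁻¹ := by
  have hbound : ∃ r : ℝ, 0 < r ∧ ∀ z ∈ A.charpoly.roots, ∀ u : ℂ, ‖u‖ < r → ‖u * z‖ < 1 := by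
    induction A.charpoly.roots using Multiset.induction with
    | empty => exact ⟨1, one_pos, by simp⟩
    | cons a s ih =>
      obtain ⟨r, hr, h⟩ := ih
      have ha : 0 < ‖a‖ + 1 := by positivity
      refine ⟨min r (‖a‖ + 1)⁻¹, lt_min hr (inv_pos.2 ha), fun z hz u hu => ?_⟩
      rcases Multiset.mem_cons.1 hz with rfl | hz
      · have h1 : ‖u‖ < (‖z‖ + 1)⁻¹ := hu.trans_le (min_le_right _ _)
        rw [norm_mul]
        calc ‖u‖ * ‖z‖ ≤ (‖z‖ + 1)⁻¹ * ‖z‖ := by gcongr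
          _ < (‖z‖ + 1)⁻¹ * (‖z‖ + 1) := by gcongr; linarith
          _ = 1 := inv_mul_cancel₀ ha.ne'
      · exact h z hz u (hu.trans_le (min_le_left _ _))
  obtain ⟨r, hr, h⟩ := hbound
  refine ⟨r, hr, fun u hu => ?_⟩
  have h' : ∀ z ∈ A.charpoly.roots, ‖u * z‖ < 1 := fun z hz => h z hz u hu
  rw [det_one_sub_smul_eq_prod_roots_charpoly]
  simp_rw [trace_pow_eq_sum_roots_charpoly]
  clear h
  generalize A.charpoly.roots = s at h' ⊢
  induction s using Multiset.induction with
  | empty => exact ⟨by simp, 0, by simp, by simp⟩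
  | cons a s ih =>
    obtain ⟨h1, S, h2, h3⟩ := ih fun z hz => h' z (Multiset.mem_cons_of_mem hz)
    have ha := h' a (Multiset.mem_cons_self a s)
    have hne : 1 - u * a ≠ 0 := by
      intro h0
      rw [← sub_eq_zero.1 h0, norm_one] at ha
      exact lt_irrefl _ ha
    refine ⟨by simp [hne, h1], -Complex.log (1 - u * a) + S, ?_, ?_⟩
    · convert (Complex.hasSum_taylorSeries_neg_log ha).add h2 using 2 with k
      rw [Multiset.map_cons, Multiset.sum_cons, add_mul, mul_pow]
      ring
    · rw [Complex.exp_add, Complex.exp_neg, Complex.exp_log hne, h3, Multiset.map_cons,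
        Multiset.prod_cons, mul_inv]

end Matrix

/-! ### Lists as periodic sequences -/

namespace CyclicPath

variable {α : Type*}

/-- The sequence obtained by repeating the list `l` forever. The values are options, so that the
empty list need not be excluded. -/
def periodic (l : List α) (i : ℕ) : Option α :=
  l[i % l.length]?

theorem periodic_add_mul_length (l : List α) (i k : ℕ) :
    periodic l (i + l.length * k) = periodic l i := by
  simp [periodic]

theorem ext_periodic {l l' : List α} (hlen : l.length = l'.length) (h : periodic l = periodic l') :
    l = l' := by
  refine List.ext_getElem? fun i => ?_
  by_cases hi : i < l.length
  · simpa [periodic, Nat.mod_eq_of_lt hi, Nat.mod_eq_of_lt (hlen ▸ hi)] using congrFun h i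
  · rw [List.getElem?_eq_none (by omega), List.getElem?_eq_none (by omega)]

@[simp] theorem length_multiple (m : ℕ) (l : List α) : (multiple m l).length = m * l.length := by
  simp [multiple]

theorem multiple_one (l : List α) : multiple 1 l = l := by simp [multiple]

theorem multiple_two (l : List α) : multiple 2 l = l ++ l := by
  simp [multiple, List.replicate_succ]

theorem periodic_multiple {m : ℕ} (hm : m ≠ 0) (l : List α) :
    periodic (multiple m l) = periodic l := by
  have key : ∀ (m i : ℕ), i < m * l.length → (multiple m l)[i]? = l[i % l.length]? := by
    intro m
    induction m with
    | zero => intro i hi; simp at hi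
    | succ m ih =>
      intro i hi
      have hs : multiple (m + 1) l = l ++ multiple m l := by
        simp [multiple, List.replicate_succ]
      rw [hs, List.getElem?_append]
      split_ifs with h
      · rw [Nat.mod_eq_of_lt h]
      · rw [ih _ (by rw [Nat.succ_mul] at hi; omega), Nat.mod_eq_sub_mod (a := i) (by omega)]
  funext i
  rcases l.length.eq_zero_or_pos with h0 | h0
  · simp [List.length_eq_zero_iff.1 h0, periodic, multiple]
  · have hpos : 0 < m * l.length := Nat.mul_pos (Nat.pos_of_ne_zero hm) h0
    rw [periodic, length_multiple, key _ _ (Nat.mod_lt _ hpos), periodic,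
      Nat.mod_mul_left_mod]

theorem multiple_multiple {m k : ℕ} (hm : m ≠ 0) (hk : k ≠ 0) (l : List α) :
    multiple m (multiple k l) = multiple (m * k) l :=
  ext_periodic (by simp [mul_assoc])
    (by rw [periodic_multiple hm, periodic_multiple hk, periodic_multiple (mul_ne_zero hm hk)])

theorem periodic_rotate (l : List α) (k i : ℕ) : periodic (l.rotate k) i = periodic l (i + k) := by
  rcases l.length.eq_zero_or_pos with h0 | h0
  · simp [List.length_eq_zero_iff.1 h0, periodic]
  · simp [periodic, List.getElem?_rotate (Nat.mod_lt i h0)]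

theorem multiple_rotate {m : ℕ} (hm : m ≠ 0) (l : List α) (k : ℕ) :
    (multiple m l).rotate k = multiple m (l.rotate k) :=
  ext_periodic (by simp) (by
    funext i
    rw [periodic_rotate, periodic_multiple hm, periodic_multiple hm, periodic_rotate])

/-- A list whose repetition has the smaller period `d`, a divisor of its length, is the multiple of
its prefix of length `d`. -/
theorem eq_multiple_take {l : List α} {d : ℕ} (hl : l ≠ []) (hd : d ∣ l.length)
    (hper : ∀ i, periodic l (i + d) = periodic l i) :
    l = multiple (l.length / d) (l.take d) := by
  have hlen : 0 < l.length := List.length_pos_iff.2 hl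
  have hd0 : 0 < d := Nat.pos_of_dvd_of_pos hd hlen
  have hdle : d ≤ l.length := Nat.le_of_dvd hlen hd
  have hq : l.length / d ≠ 0 := (Nat.div_pos hdle hd0).ne'
  have hmul : ∀ k i, periodic l (i + d * k) = periodic l i := by
    intro k
    induction k with
    | zero => simp
    | succ k ih => intro i; rw [Nat.mul_succ, ← add_assoc, hper, ih]
  refine ext_periodic (by simp [min_eq_left hdle, Nat.div_mul_cancel hd]) ?_
  funext i
  rw [periodic_multiple hq]
  conv_lhs => rw [← Nat.mod_add_div i d, hmul]
  have hlt := Nat.mod_lt i hd0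
  simp [periodic, min_eq_left hdle, Nat.mod_eq_of_lt (hlt.trans_le hdle),
    List.getElem?_take_of_lt hlt]

/-- Being a cyclic chain is a property of the infinite repetition alone; in particular a list and its
multiples are cyclic chains at the same time. -/
theorem chain_iff_periodic (r : α → α → Prop) (l : List α) :
    (l : Cycle α).Chain r ↔
      ∀ i, ∀ a ∈ periodic l i, ∀ b ∈ periodic l (i + 1), r a b := by
  cases l with
  | nil => simp [periodic]
  | cons a l =>
    rw [Cycle.chain_coe_cons, List.isChain_iff_getElem]
    have hget : ∀ i, (h : i ≤ l.length + 1) →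
        periodic (a :: l) i = some ((a :: (l ++ [a]))[i]'(by simp; omega)) := by
      intro i h
      rcases h.eq_or_lt with rfl | h
      · simp [periodic]
      · rw [periodic, List.length_cons, Nat.mod_eq_of_lt h, ← List.getElem?_eq_getElem,
          ← List.cons_append, List.getElem?_append_left (by simpa using h)]
    constructor
    · intro h i
      have hi := Nat.mod_lt i (Nat.add_one_pos l.length)
      have e1 : periodic (a :: l) i = periodic (a :: l) (i % (l.length + 1)) := by
        simp [periodic]
      have e2 : periodic (a :: l) (i + 1) = periodic (a :: l) (i % (l.length + 1) + 1) := by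
        simp [periodic]
      rw [e1, e2, hget _ (by omega), hget _ (by omega)]
      rintro _ ⟨⟩ _ ⟨⟩
      exact h _ (by simp; omega)
    · intro h i hi
      simp only [List.length_cons, List.length_append, List.length_nil] at hi
      exact h i _ (by rw [hget i (by omega)]; rfl) _ (by rw [hget (i + 1) (by omega)]; rfl)

theorem chain_multiple_iff (r : α → α → Prop) {m : ℕ} (hm : m ≠ 0) (l : List α) :
    (multiple m l : Cycle α).Chain r ↔ (l : Cycle α).Chain r := by
  rw [chain_iff_periodic, chain_iff_periodic, periodic_multiple hm]

theorem hasBacktrack_iff (bt : α → α → Prop) (l : List α) :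
    HasBacktrack bt l ↔ ¬ l.IsChain fun a b => ¬ bt a b := by
  constructor
  · rintro ⟨a, b, hab, h⟩ hc
    simpa [h] using hc.infix hab
  · intro hc
    by_contra hn
    refine hc (List.isChain_iff_forall_rel_of_append_cons_cons.2 fun a b l₁ l₂ e hb => hn ?_)
    exact ⟨a, b, ⟨l₁, l₂, by simp [e]⟩, hb⟩

/-- Two consecutive copies of a list contain all its cyclically consecutive pairs. -/
theorem isTailless_iff (bt : α → α → Prop) (l : List α) :
    IsTailless bt l ↔ (l : Cycle α).Chain fun a b => ¬ bt a b := by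
  rw [IsTailless, hasBacktrack_iff, not_not, multiple_two]
  cases l with
  | nil => simp
  | cons a l =>
    rw [Cycle.chain_coe_cons, List.cons_append]
    constructor
    · intro h
      exact h.infix ⟨[], l, by simp⟩
    · intro h
      have h2 : (a :: l).IsChain fun a b => ¬ bt a b := h.infix ⟨[], [a], by simp⟩
      have e : a :: (l ++ a :: l) = (a :: l) ++ (a :: l) := rfl
      rw [e, List.isChain_append]
      rw [← List.cons_append, List.isChain_append] at h
      exact ⟨h2, h2, by simpa using h.2.2⟩

/-! ### Unique decomposition of closed paths into multiples of primitive cycles -/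

/-- The relation `next` with the backtracks removed. Prime cycles depend only on the lists that are
cyclic chains for it. -/
def Step (next bt : α → α → Prop) (a b : α) : Prop :=
  next a b ∧ ¬ bt a b

theorem chain_step_iff (next bt : α → α → Prop) (l : List α) :
    (l : Cycle α).Chain (Step next bt) ↔
      (l : Cycle α).Chain next ∧ (l : Cycle α).Chain fun a b => ¬ bt a b := by
  simp only [chain_iff_periodic, Step]
  exact ⟨fun h => ⟨fun i a ha b hb => (h i a ha b hb).1, fun i a ha b hb => (h i a ha b hb).2⟩,
    fun h i a ha b hb => ⟨h.1 i a ha b hb, h.2 i a ha b hb⟩⟩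

variable {next bt : α → α → Prop}

/-- A primitive cycle is a nonempty cyclic chain of steps that is not a proper multiple of any
list: the absence of backtracks in the list itself is part of its being tail-less. -/
theorem isPrimitive_iff {l : List α} :
    IsPrimitive next bt l ↔ l ≠ [] ∧ (l : Cycle α).Chain (Step next bt) ∧
      ∀ (b : List α) (m : ℕ), 2 ≤ m → l ≠ multiple m b := by
  rw [IsPrimitive, isTailless_iff, chain_step_iff]
  constructor
  · rintro ⟨⟨h0, h1⟩, -, h2, h3⟩
    refine ⟨h0, ⟨h1, h2⟩, ?_⟩
    rintro b m hm rfl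
    refine h3 b m ⟨?_, (chain_multiple_iff _ (by omega) _).1 h1⟩ hm rfl
    rintro rfl
    simp [multiple] at h0
  · rintro ⟨h0, ⟨h1, h2⟩, h3⟩
    refine ⟨⟨h0, h1⟩, ?_, h2, fun b m _ hm => h3 b m hm⟩
    have h4 := (isTailless_iff _ _).2 h2
    rw [IsTailless, multiple_two] at h4
    exact fun ⟨a, b, hab, h⟩ => h4 ⟨a, b, hab.trans ⟨[], l, by simp⟩, h⟩

theorem IsPrimitive.ne_nil {l : List α} (h : IsPrimitive next bt l) : l ≠ [] := h.1.1

theorem IsPrimitive.rotate {l : List α} (h : IsPrimitive next bt l) (k : ℕ) :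
    IsPrimitive next bt (l.rotate k) := by
  rw [isPrimitive_iff] at h ⊢
  have hrot : (l.rotate k : Cycle α) = l := Cycle.coe_eq_coe.2 (List.IsRotated.forall l k)
  refine ⟨by simpa using h.1, hrot ▸ h.2.1, fun b m hm e => ?_⟩
  obtain ⟨j, hj⟩ := (List.IsRotated.forall l k)
  refine h.2.2 (b.rotate j) m hm ?_
  rw [← hj, e, multiple_rotate (by omega)]

/-- A primitive cycle of length `n`, repeated forever, has no period properly dividing `n`. -/
theorem IsPrimitive.eq_length_of_period {l : List α} (h : IsPrimitive next bt l) {d : ℕ}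
    (hd : d ∣ l.length) (hper : ∀ i, periodic l (i + d) = periodic l i) : d = l.length := by
  rw [isPrimitive_iff] at h
  by_contra hne
  have hlen : 0 < l.length := List.length_pos_iff.2 h.1
  obtain ⟨m, hm⟩ := hd
  have hd0 : 0 < d := Nat.pos_of_ne_zero (by rintro rfl; omega)
  refine h.2.2 _ _ ?_ (eq_multiple_take h.1 ⟨m, hm⟩ hper)
  rw [hm, Nat.mul_div_cancel_left _ hd0]
  rcases m with _ | _ | m
  · omega
  · omega
  · omega

/-- The periods of a sequence are closed under greatest common divisors. -/
theorem period_gcd {β : Type*} {f : ℕ → β} {a b : ℕ} (ha : ∀ i, f (i + a) = f i)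
    (hb : ∀ i, f (i + b) = f i) (i : ℕ) : f (i + a.gcd b) = f i := by
  -- A period of `f` is a period of the point `f` under the shift map.
  have iter : ∀ k i, (fun (g : ℕ → β) j => g (j + 1))^[k] f i = f (i + k) := by
    intro k
    induction k with
    | zero => simp
    | succ k ih => intro i; rw [Function.iterate_succ_apply', ih, add_assoc, add_comm 1]
  have hpa : Function.IsPeriodicPt (fun (g : ℕ → β) j => g (j + 1)) a f :=
    funext fun j => by rw [iter, ha]
  have hpb : Function.IsPeriodicPt (fun (g : ℕ → β) j => g (j + 1)) b f :=
    funext fun j => by rw [iter, hb]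
  rw [← iter]
  exact congrFun (hpa.gcd hpb) i

theorem IsPrimitive.length_dvd_of_period {l : List α} (h : IsPrimitive next bt l) {d : ℕ}
    (hper : ∀ i, periodic l (i + d) = periodic l i) : l.length ∣ d := by
  have hl : ∀ i, periodic l (i + l.length) = periodic l i := fun i => by
    simpa using periodic_add_mul_length l i 1
  rw [← h.eq_length_of_period (Nat.gcd_dvd_right d l.length) (period_gcd hper hl)]
  exact Nat.gcd_dvd_left _ _

/-- Both `r` and `s` have the same infinite repetition, so each length is a period of the other list
and hence a multiple of the other length. -/
theorem multiple_injective_of_isPrimitive {r s : List α} {m k : ℕ} (hr : IsPrimitive next bt r)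
    (hs : IsPrimitive next bt s) (hm : m ≠ 0) (hk : k ≠ 0) (h : multiple m r = multiple k s) :
    r = s ∧ m = k := by
  have hper : periodic r = periodic s := by
    rw [← periodic_multiple hm r, h, periodic_multiple hk]
  have hlen : r.length = s.length := by
    refine Nat.dvd_antisymm (hr.length_dvd_of_period fun i => ?_)
      (hs.length_dvd_of_period fun i => ?_)
    · rw [hper]; simpa using periodic_add_mul_length s i 1
    · rw [← hper]; simpa using periodic_add_mul_length r i 1
  have hl := congrArg List.length h
  rw [length_multiple, length_multiple, ← hlen] at hl
  exact ⟨ext_periodic hlen hper, Nat.eq_of_mul_eq_mul_right (List.length_pos_iff.2 hr.ne_nil) hl⟩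

theorem exists_eq_multiple_isPrimitive {l : List α} (hl : l ≠ [])
    (hc : (l : Cycle α).Chain (Step next bt)) :
    ∃ (r : List α) (m : ℕ), IsPrimitive next bt r ∧ m ≠ 0 ∧ l = multiple m r := by
  induction hn : l.length using Nat.strong_induction_on generalizing l with
  | _ n ih =>
    by_cases hp : IsPrimitive next bt l
    · exact ⟨l, 1, hp, one_ne_zero, (multiple_one l).symm⟩
    · rw [isPrimitive_iff] at hp
      push Not at hp
      obtain ⟨b, m, hm, rfl⟩ := hp hl hc
      have hm0 : m ≠ 0 := by omega
      have hb : b ≠ [] := by rintro rfl; simp [multiple] at hl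
      have hb0 := List.length_pos_iff.2 hb
      obtain ⟨r, k, hr, hk, rfl⟩ := ih b.length
        (by rw [← hn, length_multiple]; nlinarith) hb ((chain_multiple_iff _ hm0 _).1 hc) rfl
      exact ⟨r, m * k, hr, mul_ne_zero hm0 hk, multiple_multiple hm0 hk r⟩

end CyclicPath

/-! ### Counting closed chains by traces -/

namespace CyclicPath

variable {α : Type*}

/-- The `0`-`1` matrix of a relation. -/
noncomputable def relMatrix (r : α → α → Prop) : Matrix α α ℂ :=
  open Classical in Matrix.of fun a b => if r a b then 1 else 0

/-- The nonempty lists that are cyclic chains for `r`, with a marked starting point. -/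
abbrev ClosedChain (r : α → α → Prop) : Type _ :=
  {l : List α // l ≠ [] ∧ (l : Cycle α).Chain r}

/-- The lists of `k` interior points of chains from `a` to `b`. -/
abbrev ChainBetween (r : α → α → Prop) (k : ℕ) (a b : α) : Type _ :=
  {l : List α // l.length = k ∧ (a :: (l ++ [b])).IsChain r}

instance [Finite α] (r : α → α → Prop) (k : ℕ) (a b : α) : Finite (ChainBetween r k a b) :=
  ((List.finite_length_eq α k).subset fun _ h => h.1).to_subtype

instance [Finite α] (r : α → α → Prop) (k : ℕ) :
    Finite {c : ClosedChain r // c.1.length = k} := by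
  have := (List.finite_length_eq α k).to_subtype
  exact Finite.of_injective
    (fun c : {c : ClosedChain r // c.1.length = k} => (⟨c.1.1, c.2⟩ : {l : List α | l.length = k}))
    fun c d h => Subtype.ext (Subtype.ext (Subtype.mk.inj h))

theorem card_chainBetween [Fintype α] [DecidableEq α] (r : α → α → Prop) (k : ℕ) (a b : α) :
    (Nat.card (ChainBetween r k a b) : ℂ) = (relMatrix r ^ (k + 1)) a b := by
  classical
  induction k generalizing a with
  | zero =>
    rw [zero_add, pow_one]
    by_cases h : r a b
    · have : Unique (ChainBetween r 0 a b) :=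
        { default := ⟨[], by simpa using h⟩
          uniq := fun l => Subtype.ext (List.length_eq_zero_iff.1 l.2.1) }
      simp [relMatrix, h]
    · have : IsEmpty (ChainBetween r 0 a b) := by
        refine ⟨fun ⟨l, h0, hl⟩ => h ?_⟩
        obtain rfl := List.length_eq_zero_iff.1 h0
        simpa using hl
      simp [relMatrix, h]
  | succ k ih =>
    let e : ChainBetween r (k + 1) a b ≃ Σ c : {c // r a c}, ChainBetween r k c b :=
      { toFun := fun
          | ⟨[], h⟩ => absurd h.1 (by simp)
          | ⟨c :: l, h⟩ => ⟨⟨c, by simpa using (List.isChain_cons_cons.1 h.2).1⟩,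
              ⟨l, by simpa using h.1, (List.isChain_cons_cons.1 h.2).2⟩⟩
        invFun := fun p => ⟨p.1.1 :: p.2.1, by simpa using p.2.2.1,
          List.isChain_cons_cons.2 ⟨p.1.2, p.2.2.2⟩⟩
        left_inv := by
          rintro ⟨_ | ⟨c, l⟩, h⟩
          · exact absurd h.1 (by simp)
          · rfl
        right_inv := fun _ => rfl }
    rw [Nat.card_congr e, Nat.card_sigma, pow_succ', Matrix.mul_apply, Nat.cast_sum]
    simp_rw [ih]
    refine (Finset.sum_subtype (Finset.univ.filter (r a)) (by simp)
      fun c => (relMatrix r ^ (k + 1)) c b).symm.trans ?_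
    rw [Finset.sum_filter]
    refine Finset.sum_congr rfl fun c _ => ?_
    by_cases h : r a c <;> simp [relMatrix, h]

/-- The closed chains of length `k + 1` are counted by the trace of the `(k + 1)`-st power. -/
theorem card_closedChain [Fintype α] [DecidableEq α] (r : α → α → Prop) (k : ℕ) :
    (Nat.card {c : ClosedChain r // c.1.length = k + 1} : ℂ) = (relMatrix r ^ (k + 1)).trace := by
  let e : {c : ClosedChain r // c.1.length = k + 1} ≃ Σ a, ChainBetween r k a a :=
    { toFun := fun
        | ⟨⟨[], h⟩, _⟩ => absurd rfl h.1
        | ⟨⟨a :: l, h⟩, hl⟩ => ⟨a, l, by simpa using hl, h.2⟩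
      invFun := fun p => ⟨⟨p.1 :: p.2.1, by simp, p.2.2.2⟩, by simpa using p.2.2.1⟩
      left_inv := by
        rintro ⟨⟨_ | ⟨a, l⟩, h⟩, hl⟩
        · exact absurd rfl h.1
        · rfl
      right_inv := fun _ => rfl }
  rw [Nat.card_congr e, Nat.card_sigma, Nat.cast_sum, Matrix.trace]
  simp_rw [card_chainBetween]
  rfl

/-- Grouping closed chains by length turns the trace series into a sum over closed chains. -/
theorem hasSum_closedChain [Fintype α] [DecidableEq α] {r : α → α → Prop} {u S : ℂ}
    (h : HasSum (fun k : ℕ => (relMatrix r ^ k).trace * (u ^ k / k)) S) :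
    HasSum (fun c : ClosedChain r => u ^ c.1.length / (c.1.length : ℂ)) S := by
  have hcard (k : ℕ) : (Nat.card {c : ClosedChain r // c.1.length = k} : ℂ) * (u ^ k / k) =
      (relMatrix r ^ k).trace * (u ^ k / k) := by
    rcases k with _ | k
    · simp
    · rw [card_closedChain]
  have hfiber (k : ℕ) : HasSum (fun c : {c : ClosedChain r // c.1.length = k} =>
      u ^ c.1.1.length / (c.1.1.length : ℂ)) ((relMatrix r ^ k).trace * (u ^ k / k)) := by
    have := Fintype.ofFinite {c : ClosedChain r // c.1.length = k}
    convert hasSum_fintype (fun c : {c : ClosedChain r // c.1.length = k} =>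
      u ^ c.1.1.length / (c.1.1.length : ℂ)) using 1
    rw [← hcard, Finset.sum_congr rfl fun c _ => by rw [c.2], Finset.sum_const,
      Finset.card_univ, Nat.card_eq_fintype_card, nsmul_eq_mul]
  rw [← (Equiv.sigmaFiberEquiv fun c : ClosedChain r => c.1.length).hasSum_iff]
  refine HasSum.sigma_of_hasSum h hfiber (Summable.of_norm ?_)
  rw [summable_sigma_of_nonneg fun _ => norm_nonneg _]
  refine ⟨fun k => Summable.of_finite, h.summable.norm.congr fun k => ?_⟩
  have := Fintype.ofFinite {c : ClosedChain r // c.1.length = k}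
  rw [← hcard, tsum_fintype]
  simp only [Function.comp_apply, Equiv.sigmaFiberEquiv_apply]
  rw [Finset.sum_congr rfl fun c _ => by rw [c.2], Finset.sum_const, Finset.card_univ,
    Nat.card_eq_fintype_card, nsmul_eq_mul, norm_mul, Complex.norm_natCast]

/-! ### The Euler product -/

variable {next bt : α → α → Prop}

/-- Every closed chain is, in exactly one way, a positive multiple of a primitive cycle. -/
noncomputable def closedChainEquiv (next bt : α → α → Prop) :
    {l // IsPrimitive next bt l} × ℕ ≃ ClosedChain (Step next bt) :=
  Equiv.ofBijective
    (fun p => ⟨multiple (p.2 + 1) p.1.1, by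
      have h := isPrimitive_iff.1 p.1.2
      refine ⟨?_, (chain_multiple_iff _ p.2.succ_ne_zero _).2 h.2.1⟩
      rw [← List.length_pos_iff, length_multiple]
      exact Nat.mul_pos p.2.succ_pos (List.length_pos_iff.2 h.1)⟩) <| by
    constructor
    · rintro ⟨⟨r, hr⟩, m⟩ ⟨⟨s, hs⟩, k⟩ h
      obtain ⟨rfl, h2⟩ := multiple_injective_of_isPrimitive hr hs m.succ_ne_zero k.succ_ne_zero
        (congrArg Subtype.val h)
      simpa using h2
    · rintro ⟨l, hl, hc⟩
      obtain ⟨r, m, hr, hm, rfl⟩ := exists_eq_multiple_isPrimitive hl hc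
      obtain ⟨k, rfl⟩ := Nat.exists_eq_succ_of_ne_zero hm
      exact ⟨⟨⟨r, hr⟩, k⟩, rfl⟩

/-- The class under cyclic permutation of a primitive cycle. -/
def toPrime (l : {l // IsPrimitive next bt l}) : primeCycles next bt :=
  ⟨l.1, l.1, l.2, rfl⟩

/-- A prime cycle of length `n` is the class of exactly `n` primitive cycles: its rotations by
`0, …, n - 1` steps. -/
theorem exists_equiv_toPrime_fiber (p : primeCycles next bt) :
    Nonempty (Fin (p : Cycle α).length ≃ {l // toPrime l = p}) := by
  obtain ⟨_, l, hl, rfl⟩ := p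
  have hpos := List.length_pos_iff.2 hl.ne_nil
  refine ⟨Equiv.ofBijective (fun i => ⟨⟨l.rotate i, hl.rotate i⟩,
    Subtype.ext (Cycle.coe_eq_coe.2 (List.IsRotated.forall l i))⟩) ⟨?_, ?_⟩⟩
  · have key : ∀ i j : ℕ, i ≤ j → j < l.length → l.rotate i = l.rotate j → i = j := by
      intro i j hij hj h
      have hdvd := (hl.rotate i).length_dvd_of_period (d := j - i) fun k => by
        conv_rhs => rw [h]
        rw [periodic_rotate, periodic_rotate]
        congr 1
        omega
      rw [List.length_rotate] at hdvd
      have := Nat.eq_zero_of_dvd_of_lt hdvd (by omega)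
      omega
    rintro ⟨i, hi⟩ ⟨j, hj⟩ h
    have h' : l.rotate i = l.rotate j := congrArg (fun x => x.1.1) h
    refine Fin.ext ?_
    rcases le_total i j with hij | hij
    · exact key i j hij hj h'
    · exact (key j i hij hi h'.symm).symm
  · rintro ⟨⟨l', hl'⟩, h⟩
    obtain ⟨k, hk⟩ := (Cycle.coe_eq_coe.1 (congrArg Subtype.val h)).symm
    exact ⟨⟨k % l.length, Nat.mod_lt _ hpos⟩,
      Subtype.ext (Subtype.ext ((List.rotate_mod l k).trans hk))⟩

theorem length_pos_of_prime (p : primeCycles next bt) : 0 < (p : Cycle α).length := by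
  obtain ⟨_, l, hl, rfl⟩ := p
  exact List.length_pos_iff.2 hl.ne_nil

/-- In the sum over closed chains, a prime cycle of length `n` contributes `n` primitive cycles, and
the multiples of each of them contribute `∑ u ^ (n m) / (n m) = -log (1 - u ^ n) / n`. -/
theorem hasSum_prime_log {u S : ℂ} (hu : ‖u‖ < 1)
    (h : HasSum (fun c : ClosedChain (Step next bt) => u ^ c.1.length / (c.1.length : ℂ)) S) :
    HasSum (fun p : primeCycles next bt => -Complex.log (1 - u ^ (p : Cycle α).length)) S := by
  rw [← (closedChainEquiv next bt).hasSum_iff] at h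
  have hprim := h.prod_fiberwise (g := fun l : {l // IsPrimitive next bt l} =>
      (l.1.length : ℂ)⁻¹ * -Complex.log (1 - u ^ l.1.length)) fun l => by
    have hlen : l.1.length ≠ 0 := (List.length_pos_iff.2 l.2.ne_nil).ne'
    have hlt : ‖u ^ l.1.length‖ < 1 := by
      rw [norm_pow]; exact pow_lt_one₀ (norm_nonneg u) hu hlen
    -- The Taylor series has a vanishing term at index `0`; the multiplicities `k + 1` skip it.
    have h1 : HasSum (fun k : ℕ => (u ^ l.1.length) ^ (k + 1) / ((k + 1 : ℕ) : ℂ))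
        (-Complex.log (1 - u ^ l.1.length)) := by
      simpa using (hasSum_nat_add_iff' 1).2 (Complex.hasSum_taylorSeries_neg_log hlt)
    refine (congrArg (HasSum · _) (funext fun k => ?_)).mpr (h1.mul_left ((l.1.length : ℂ)⁻¹))
    have hk : (closedChainEquiv next bt (l, k)).1.length = (k + 1) * l.1.length :=
      length_multiple (k + 1) l.1
    simp only [Function.comp_apply, hk, ← pow_mul, mul_comm l.1.length]
    push_cast
    field_simp
  rw [← (Equiv.sigmaFiberEquiv (toPrime (next := next) (bt := bt))).hasSum_iff] at hprim
  refine hprim.sigma fun p => ?_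
  obtain ⟨e⟩ := exists_equiv_toPrime_fiber p
  rw [← e.hasSum_iff]
  convert hasSum_fintype _ using 1
  have hlen : ((p : Cycle α).length : ℂ) ≠ 0 := Nat.cast_ne_zero.2 (length_pos_of_prime p).ne'
  rw [Finset.sum_congr rfl (g := fun _ => ((p : Cycle α).length : ℂ)⁻¹ *
    -Complex.log (1 - u ^ (p : Cycle α).length)) fun i _ => ?_]
  · rw [Finset.sum_const, Finset.card_univ, Fintype.card_fin, nsmul_eq_mul, ← mul_assoc,
      mul_inv_cancel₀ hlen, one_mul]
  · have hl : (e i).1.1.length = (p : Cycle α).length := by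
      conv_rhs => rw [← (e i).2]
      rfl
    simp only [Function.comp_apply, Equiv.sigmaFiberEquiv_apply, hl]

/-- For small `u`, the Euler product over the prime cycles of a finite alphabet is the reciprocal of
`det (1 - u M)`, where `M` is the `0`-`1` matrix of the steps without backtracks. -/
theorem exists_hasProd_primeCycles [Fintype α] [DecidableEq α] (next bt : α → α → Prop) :
    ∃ r : ℝ, 0 < r ∧ r ≤ 1 ∧ ∀ u : ℂ, ‖u‖ < r → (1 - u • relMatrix (Step next bt)).det ≠ 0 ∧
      HasProd (fun p : primeCycles next bt => (1 - u ^ (p : Cycle α).length)⁻¹)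
        ((1 - u • relMatrix (Step next bt)).det)⁻¹ := by
  obtain ⟨r, hr, h⟩ := Matrix.exists_hasSum_trace_pow (relMatrix (Step next bt))
  refine ⟨min r 1, lt_min hr one_pos, min_le_right _ _, fun u hu => ?_⟩
  obtain ⟨hdet, S, hS, hexp⟩ := h u (hu.trans_le (min_le_left _ _))
  have hu1 : ‖u‖ < 1 := hu.trans_le (min_le_right _ _)
  refine ⟨hdet, ?_⟩
  rw [← hexp]
  convert (hasSum_prime_log hu1 (hasSum_closedChain hS)).cexp using 1
  funext p
  have hne : 1 - u ^ (p : Cycle α).length ≠ 0 := by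
    intro h0
    have h1 := pow_lt_one₀ (norm_nonneg u) hu1 (length_pos_of_prime p).ne'
    rw [← norm_pow, ← sub_eq_zero.1 h0, norm_one] at h1
    exact lt_irrefl _ h1
  rw [Function.comp_apply, Complex.exp_neg, Complex.exp_log hne]

end CyclicPath

/-! ### The Ihara-Bass determinant formula -/

namespace SimpleGraph

open Matrix CyclicPath

variable {W : Type*} [DecidableEq W] (G : SimpleGraph W)

/-- The permutation matrix of the reversal of darts. -/
def dartReversal : Matrix G.Dart G.Dart ℂ :=
  Matrix.of fun d d' => if d' = d.symm then 1 else 0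

/-- The incidence matrix of vertices and the darts that start there. -/
def startMatrix : Matrix W G.Dart ℂ :=
  Matrix.of fun v d => if d.fst = v then 1 else 0

/-- The incidence matrix of vertices and the darts that end there. -/
def endMatrix : Matrix W G.Dart ℂ :=
  Matrix.of fun v d => if d.snd = v then 1 else 0

/-- The edge matrix of the graph: the `0`-`1` matrix of the steps without backtracks. -/
noncomputable abbrev edgeMatrix : Matrix G.Dart G.Dart ℂ :=
  relMatrix (Step G.DartAdj fun d d' => d' = d.symm)

variable [Fintype W]

/-- To continue a dart is to move on from its end point, except that the reversal is excluded. -/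
theorem edgeMatrix_eq : G.edgeMatrix = G.endMatrixᵀ * G.startMatrix - G.dartReversal := by
  ext d d'
  by_cases h : d' = d.symm
  · simp [relMatrix, Step, endMatrix, startMatrix, dartReversal, Matrix.mul_apply, h]
  · simp [relMatrix, Step, endMatrix, startMatrix, dartReversal, Matrix.mul_apply, h, DartAdj,
      eq_comm]

variable [DecidableRel G.Adj]

theorem dartReversal_mul_self : G.dartReversal * G.dartReversal = 1 := by
  ext d d'
  rw [Matrix.mul_apply, Finset.sum_eq_single d.symm]
  · simp [dartReversal, Matrix.one_apply, eq_comm]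
  · intro k _ hk
    simp [dartReversal, hk]
  · simp

theorem dartReversal_mul_transpose_endMatrix :
    G.dartReversal * G.endMatrixᵀ = G.startMatrixᵀ := by
  ext d v
  rw [Matrix.mul_apply, Finset.sum_eq_single d.symm]
  · simp [dartReversal, endMatrix, startMatrix]
  · intro k _ hk
    simp [dartReversal, hk]
  · simp

theorem startMatrix_mul_transpose_endMatrix :
    G.startMatrix * G.endMatrixᵀ = G.adjMatrix ℂ := by
  ext v w
  simp only [startMatrix, endMatrix, Matrix.mul_apply, Matrix.transpose_apply, Matrix.of_apply,
    adjMatrix_apply]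
  split_ifs with h
  · rw [Finset.sum_eq_single (⟨(v, w), h⟩ : G.Dart)]
    · simp
    · intro d _ hd
      by_cases h1 : d.fst = v
      · by_cases h2 : d.snd = w
        · exact absurd (Dart.ext _ _ (Prod.ext h1 h2)) hd
        · simp [h2]
      · simp [h1]
    · simp
  · refine Finset.sum_eq_zero fun d _ => ?_
    by_cases h1 : d.fst = v
    · by_cases h2 : d.snd = w
      · exact absurd (h1 ▸ h2 ▸ d.adj) h
      · simp [h2]
    · simp [h1]

theorem startMatrix_mul_transpose_startMatrix :
    G.startMatrix * G.startMatrixᵀ = diagonal fun v => (G.degree v : ℂ) := by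
  ext v w
  rw [Matrix.mul_apply, Matrix.diagonal_apply]
  split_ifs with h
  · subst h
    rw [← G.dart_fst_fiber_card_eq_degree v, Finset.natCast_card_filter]
    refine Finset.sum_congr rfl fun d _ => ?_
    simp [startMatrix]
  · refine Finset.sum_eq_zero fun d _ => ?_
    by_cases h1 : d.fst = v
    · simp [startMatrix, h1, h]
    · simp [startMatrix, h1]

/-- Orienting every edge splits the darts into two halves exchanged by the reversal, and with
respect to this splitting `1 + s J` is a block matrix with identity blocks on the diagonal. -/
theorem det_one_add_smul_dartReversal (s : ℂ) :
    (1 + s • G.dartReversal).det = (1 - s ^ 2) ^ G.edgeFinset.card := by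
  classical
  let _ : LinearOrder W := linearOrderOfSTO (WellOrderingRel (α := W))
  let P : G.Dart → Prop := fun d => d.fst < d.snd
  have hP (d : G.Dart) : P d.symm ↔ ¬ P d :=
    ⟨fun h h' => lt_asymm h h', fun h => lt_of_le_of_ne (not_lt.1 h) d.snd_ne_fst⟩
  have hcard : Fintype.card {d // P d} = G.edgeFinset.card := by
    have e : {d // P d} ≃ {d // ¬ P d} :=
      (Dart.symm_involutive (G := G)).toPerm.subtypeEquiv fun d => by
        change P d ↔ ¬ P d.symm
        rw [hP, not_not]
    have h1 := Fintype.card_subtype_compl P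
    have h2 := Fintype.card_subtype_le P
    have h3 := G.dart_card_eq_twice_card_edges
    have h4 := Fintype.card_congr e
    omega
  rw [det_toBlock _ P]
  have h11 : (1 + s • G.dartReversal).toBlock P P = 1 := by
    ext ⟨i, hi⟩ ⟨j, hj⟩
    have : j ≠ i.symm := fun h => (hP i).1 (h ▸ hj) hi
    simp [dartReversal, this, Matrix.one_apply]
  have h22 : (1 + s • G.dartReversal).toBlock (fun d => ¬ P d) (fun d => ¬ P d) = 1 := by
    ext ⟨i, hi⟩ ⟨j, hj⟩
    have : j ≠ i.symm := fun h => hj (h ▸ (hP i).2 hi)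
    simp [dartReversal, this, Matrix.one_apply]
  have h12 : (1 + s • G.dartReversal).toBlock P (fun d => ¬ P d) *
      (1 + s • G.dartReversal).toBlock (fun d => ¬ P d) P = s ^ 2 • 1 := by
    ext ⟨i, hi⟩ ⟨j, hj⟩
    have hi' : ¬ P i.symm := fun h => (hP i).1 h hi
    rw [Matrix.mul_apply, Finset.sum_eq_single ⟨i.symm, hi'⟩]
    · have h1 : i ≠ i.symm := i.symm_ne.symm
      have h2 : i.symm ≠ j := fun h => hi' (h ▸ hj)
      by_cases h : i = j
      · subst h
        simp [dartReversal, h1, h2, sq]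
      · simp [dartReversal, h1, h2, h, Ne.symm h]
    · rintro ⟨k, hk⟩ - hne
      have h1 : i ≠ k := fun h => hk (h ▸ hi)
      have h2 : k ≠ i.symm := fun h => hne (Subtype.ext h)
      simp [dartReversal, Matrix.one_apply, h1, h2]
    · simp
  rw [h11, h22, det_fromBlocks_one₂₂, h12, ← hcard]
  have h : (1 : Matrix {d // P d} {d // P d} ℂ) - s ^ 2 • 1 = (1 - s ^ 2) • 1 := by
    rw [sub_smul, one_smul]
  rw [h, det_smul, det_one, mul_one]

/-- **The Ihara-Bass formula.** -/
theorem det_one_sub_adjMatrix_add_degree {s : ℂ} (hs : 1 - s ^ 2 ≠ 0) :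
    (1 - s • G.adjMatrix ℂ + s ^ 2 • (diagonal (fun v => (G.degree v : ℂ)) - 1)).det =
      (1 - s ^ 2) ^ G.eulerNumber * (1 - s • G.edgeMatrix).det := by
  set c : ℂ := s / (1 - s ^ 2) with hc
  set J := G.dartReversal
  have hJ : (1 + s • J) * (1 - s • J) = (1 - s ^ 2) • 1 := by
    have h : J * J = 1 := G.dartReversal_mul_self
    simp only [add_mul, mul_sub, one_mul, mul_one, smul_mul_assoc, mul_smul_comm, h]
    module
  have hfactor : 1 - s • G.edgeMatrix =
      (1 + s • J) * (1 - (c • ((1 - s • J) * G.endMatrixᵀ)) * G.startMatrix) := by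
    rw [mul_sub, mul_one, Matrix.smul_mul, Matrix.mul_smul, ← Matrix.mul_assoc, ← Matrix.mul_assoc,
      hJ, Matrix.smul_mul, Matrix.one_mul, Matrix.smul_mul, smul_smul, hc, div_mul_cancel₀ _ hs,
      edgeMatrix_eq, smul_sub]
    abel
  have hvertex : G.startMatrix * (c • ((1 - s • J) * G.endMatrixᵀ)) =
      c • (G.adjMatrix ℂ - s • diagonal fun v => (G.degree v : ℂ)) := by
    rw [Matrix.mul_smul, Matrix.sub_mul, Matrix.one_mul, Matrix.smul_mul,
      dartReversal_mul_transpose_endMatrix, Matrix.mul_sub, Matrix.mul_smul,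
      startMatrix_mul_transpose_endMatrix, startMatrix_mul_transpose_startMatrix]
  have hscale : 1 - s • G.adjMatrix ℂ + s ^ 2 • (diagonal (fun v => (G.degree v : ℂ)) - 1) =
      (1 - s ^ 2) • (1 - c • (G.adjMatrix ℂ - s • diagonal fun v => (G.degree v : ℂ))) := by
    rw [smul_sub (1 - s ^ 2), smul_smul, hc, mul_div_cancel₀ _ hs]
    module
  have hcomm : ∀ (X : Matrix G.Dart W ℂ) (Y : Matrix W G.Dart ℂ),
      (1 - X * Y).det = (1 - Y * X).det := by
    intro X Y
    rw [sub_eq_add_neg, ← Matrix.neg_mul, det_one_add_mul_comm, Matrix.mul_neg, ← sub_eq_add_neg]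
  rw [hfactor, det_mul, hcomm, hvertex, G.det_one_add_smul_dartReversal, hscale, det_smul,
    eulerNumber, zpow_sub₀ hs, zpow_natCast, zpow_natCast, ← mul_assoc,
    div_mul_cancel₀ _ (pow_ne_zero _ hs)]

end SimpleGraph

/-! ### The incidence graph of a hypergraph -/

namespace MultiHypergraph

open Matrix CyclicPath

variable {V E : Type*} (H : MultiHypergraph V E)

/-- The incident pairs of a hypervertex and a hyperedge. -/
abbrev Flag : Type _ :=
  {p : V × E // p.1 ∈ H.edge p.2}

/-- The darts of the incidence graph lead from a hypervertex to a hyperedge (left summand) or from a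
hyperedge to a hypervertex (right summand). -/
def flagSumFlagEquivDart : H.Flag ⊕ H.Flag ≃ H.incidenceGraph.Dart where
  toFun
    | Sum.inl p => ⟨(Sum.inl p.1.1, Sum.inr p.1.2), p.2⟩
    | Sum.inr p => ⟨(Sum.inr p.1.2, Sum.inl p.1.1), p.2⟩
  invFun
    | ⟨(Sum.inl v, Sum.inr e), h⟩ => Sum.inl ⟨(v, e), h⟩
    | ⟨(Sum.inr e, Sum.inl v), h⟩ => Sum.inr ⟨(v, e), h⟩
    | ⟨(Sum.inl _, Sum.inl _), h⟩ => h.elim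
    | ⟨(Sum.inr _, Sum.inr _), h⟩ => h.elim
  left_inv := by rintro (p | p) <;> rfl
  right_inv := by
    rintro ⟨⟨v | e, w | f⟩, h⟩
    · exact h.elim
    · rfl
    · rfl
    · exact h.elim

/-- The `0`-`1` matrix of the steps of the hypergraph without hyperedge backtracks. -/
noncomputable abbrev stepMatrix : Matrix (V × E) (V × E) ℂ :=
  relMatrix (Step H.Next fun p q => p.2 = q.2)

/-- Passage from `v → e` to `e → w` without return to `v`. -/
noncomputable def throughEdge : Matrix H.Flag H.Flag ℂ :=
  relMatrix fun p q => q.1.2 = p.1.2 ∧ q.1.1 ≠ p.1.1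

/-- Passage from `e → v` to `v → f` without return to `e`. -/
noncomputable def throughVertex : Matrix H.Flag H.Flag ℂ :=
  relMatrix fun p q => q.1.1 = p.1.1 ∧ q.1.2 ≠ p.1.2

variable [Fintype V] [DecidableEq V] [Fintype E] [DecidableEq E]

/-- Two consecutive steps in the incidence graph make up one step in the hypergraph. -/
theorem throughEdge_mul_throughVertex :
    H.throughEdge * H.throughVertex = H.stepMatrix.toSquareBlockProp fun p => p.1 ∈ H.edge p.2 := by
  classical
  ext ⟨⟨v, e⟩, hp⟩ ⟨⟨w, f⟩, hq⟩
  simp only [Matrix.mul_apply, throughEdge, throughVertex, relMatrix, Matrix.of_apply,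
    toSquareBlockProp_def]
  -- The only possible intermediate flag is `(w, e)`.
  by_cases hw : w ∈ H.edge e
  · rw [Finset.sum_eq_single (⟨(w, e), hw⟩ : H.Flag)]
    · rcases eq_or_ne v w with rfl | h1
      · simp [Step, Next]
      · rcases eq_or_ne e f with rfl | h2
        · simp [Step]
        · have hp' : v ∈ H.edge e := hp
          simp [Step, Next, hp', hw, h1, h1.symm, h2, h2.symm]
    · rintro ⟨⟨x, g⟩, hr⟩ - hne
      by_cases h1 : g = e
      · by_cases h2 : w = x
        · exact absurd (by simp [h1, h2]) hne
        · simp [h2]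
      · simp [h1]
    · simp
  · rw [if_neg fun h => hw h.1.2.1]
    refine Finset.sum_eq_zero ?_
    rintro ⟨⟨x, g⟩, hr⟩ -
    by_cases h1 : g = e
    · by_cases h2 : w = x
      · exact absurd (by simpa [h1, h2] using hr) hw
      · simp [h2]
    · simp [h1]

/-- The rows of the step matrix that belong to pairs that are not incident vanish, so that these
pairs do not contribute to the determinant. -/
theorem det_one_sub_smul_stepMatrix (u : ℂ) :
    (1 - u • H.stepMatrix).det = (1 - u • (H.throughEdge * H.throughVertex)).det := by
  classical
  have hrow : ∀ p q : V × E, ¬ p.1 ∈ H.edge p.2 → H.stepMatrix p q = 0 := fun p q hp => by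
    simp [relMatrix, Step, Next, hp]
  rw [twoBlockTriangular_det _ fun p : V × E => p.1 ∈ H.edge p.2]
  · have h2 : (1 - u • H.stepMatrix).toSquareBlockProp (fun p => ¬ p.1 ∈ H.edge p.2) = 1 := by
      ext p q
      simp [toSquareBlockProp_def, hrow p.1 q.1 p.2, Matrix.one_apply, Subtype.ext_iff]
    rw [h2, det_one, mul_one, throughEdge_mul_throughVertex]
    congr 1
    ext p q
    simp [toSquareBlockProp_def, Matrix.one_apply, Subtype.ext_iff]
  · intro p hp q hq
    have hne : p ≠ q := fun h => hp (h ▸ hq)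
    simp [hrow p q hp, hne]

/-- The incidence graph is bipartite, so its edge matrix is block off-diagonal, and the product of
the two blocks is the step matrix of the hypergraph. -/
theorem det_one_sub_smul_edgeMatrix (s : ℂ) :
    (1 - s • H.incidenceGraph.edgeMatrix).det = (1 - s ^ 2 • H.stepMatrix).det := by
  classical
  have hblock : (1 - s • H.incidenceGraph.edgeMatrix).submatrix H.flagSumFlagEquivDart
      H.flagSumFlagEquivDart = fromBlocks 1 (-(s • H.throughEdge)) (-(s • H.throughVertex)) 1 := by
    ext (p | p) (q | q)
    all_goals
      obtain ⟨⟨v, e⟩, hp⟩ := p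
      obtain ⟨⟨w, f⟩, hq⟩ := q
      simp [flagSumFlagEquivDart, relMatrix, Step, SimpleGraph.DartAdj, SimpleGraph.Dart.ext_iff,
        SimpleGraph.Dart.symm, throughEdge, throughVertex, Matrix.one_apply, eq_comm]
      try by_cases h₁ : v = w <;> by_cases h₂ : e = f <;> simp [h₁, h₂]
  rw [← det_submatrix_equiv_self H.flagSumFlagEquivDart, hblock, det_fromBlocks_one₂₂,
    det_one_sub_smul_stepMatrix, neg_mul_neg, smul_mul_smul_comm, sq]

end MultiHypergraph

/-! ### Comparison of the two zeta functions -/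

theorem mainTheorem5 {V E : Type*} [Fintype V] [DecidableEq V] [Fintype E] [DecidableEq E]
    (H : MultiHypergraph V E) (hconn : H.Connected)
    (hdeg : ∀ v : V, 2 ≤ (Finset.univ.filter (fun e : E => v ∈ H.edge e)).card) :
    ∃ R : ℝ, 0 < R ∧ R ≤ 1 ∧ ∀ u s : ℂ, ‖u‖ < R → s ^ 2 = u →
      Multipliable (H.zetaFactor u) ∧
      Multipliable (H.incidenceGraph.iharaFactor s) ∧
      (1 - s • H.adjOperator + u • H.qOperator).det ≠ 0 ∧
      H.zeta u = H.incidenceGraph.iharaZeta s ∧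
      H.zeta u = (1 - u) ^ H.incidenceGraph.eulerNumber *
        ((1 - s • H.adjOperator + u • H.qOperator).det)⁻¹ := by
  obtain ⟨r₁, hr₁, hr₁', h₁⟩ :=
    CyclicPath.exists_hasProd_primeCycles H.Next fun p q => p.2 = q.2
  obtain ⟨r₂, hr₂, -, h₂⟩ := CyclicPath.exists_hasProd_primeCycles H.incidenceGraph.DartAdj
    fun d d' => d' = d.symm
  -- The graph product is evaluated at a square root of `u`, hence the square of its radius.
  refine ⟨min r₁ (r₂ ^ 2), lt_min hr₁ (by positivity), (min_le_left _ _).trans hr₁', ?_⟩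
  rintro _ s hu rfl
  have hu₁ : ‖s ^ 2‖ < r₁ := hu.trans_le (min_le_left _ _)
  have hs : ‖s‖ < r₂ := by
    have : ‖s‖ ^ 2 < r₂ ^ 2 := by simpa using hu.trans_le (min_le_right _ _)
    exact lt_of_pow_lt_pow_left₀ 2 hr₂.le this
  obtain ⟨hdet₁, hprod₁⟩ := h₁ _ hu₁
  obtain ⟨hdet₂, hprod₂⟩ := h₂ s hs
  have hne : 1 - s ^ 2 ≠ 0 := by
    intro h0
    have := hu₁.trans_le hr₁'
    rw [← sub_eq_zero.1 h0, norm_one] at this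
    exact lt_irrefl _ this
  have hbass : (1 - s • H.adjOperator + s ^ 2 • H.qOperator).det =
      (1 - s ^ 2) ^ H.incidenceGraph.eulerNumber * (1 - s • H.incidenceGraph.edgeMatrix).det :=
    H.incidenceGraph.det_one_sub_adjMatrix_add_degree hne
  have hzeta : H.zeta (s ^ 2) = ((1 - s ^ 2 • H.stepMatrix).det)⁻¹ := hprod₁.tprod_eq
  have hihara : H.incidenceGraph.iharaZeta s =
      ((1 - s • H.incidenceGraph.edgeMatrix).det)⁻¹ := hprod₂.tprod_eq
  have hpow : (1 - s ^ 2) ^ H.incidenceGraph.eulerNumber ≠ 0 := zpow_ne_zero _ hne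
  refine ⟨hprod₁.multipliable, hprod₂.multipliable, ?_, ?_, ?_⟩
  · rw [hbass]
    exact mul_ne_zero hpow hdet₂
  · rw [hzeta, hihara, H.det_one_sub_smul_edgeMatrix]
  · rw [hzeta, hbass, H.det_one_sub_smul_edgeMatrix, mul_inv, ← mul_assoc, mul_inv_cancel₀ hpow,
      one_mul]
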